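/- A quantum set $\mathcal X=\{X_\alpha\}_\alpha$ is a family of finite-dimensional complex Hilbert spaces (its atoms), and $H_{\mathcal X}=\bigoplus_\alpha X_\alpha$ is their Hilbert space direct sum. Write $\ell^\infty(\mathcal X)=\{(a_\alpha)_\alpha : a_\alpha\in L(X_\alpha),\ \sup_\alpha\|a_\alpha\|<\infty\}$, a von Neumann algebra acting on $H_{\mathcal X}$. A $W^*$-morphism is a unital normal (weak$^*$-continuous) $*$-homomorphism. A relation $R:\mathcal X\to\mathcal Y$ is a choice of linear subspaces $R(X_\alpha,Y_\beta)\le L(X_\alpha,Y_\beta)$ for all atoms $X_\alpha$ of $\mathcal X$ and $Y_\beta$ of $\mathcal Y$. Composition and dagger of relations are given by $$(S\circ R)(X_\alpha,Z_\gamma)=\operatorname{span}\bigcup_\beta\{sr: s\in S(Y_\beta,Z_\gamma),\ r\in R(X_\alpha,Y_\beta)\},\qquad R^\dagger(Y_\beta,X_\alpha)=\{r^*: r\in R(X_\alpha,Y_\beta)\}.$$ A $W^*$-morphism $\psi:\ell^\infty(\mathcal Y)\to\ell^\infty(\mathcal X)$ has an associated relation $\hat\psi:\mathcal X\to\mathcal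 Y$, where $\hat\psi(X_\alpha,Y_\beta)$ is the space of all compressions $\mathrm{id}_{Y_\beta}T\,\mathrm{id}_{X_\alpha}$ of bounded operators $T:H_{\mathcal X}\to H_{\mathcal Y}$ with $aT=T\psi(a)$ for all $a\in\ell^\infty(\mathcal Y)$. Let $$A_{\mathcal X,\mathcal Y}:=\ell^\infty(\mathcal X)\mathbin{\overline\otimes}\ell^\infty(\mathcal Y)^{op}\cong\prod^{W^*}_{\alpha,\beta}L(X_\alpha)\otimes L(Y_\beta)^{op},$$ acting on the right, entrywise, on $\prod_{\alpha,\beta}L(X_\alpha,Y_\beta)$ by $x(a\otimes b)=bxa$. Each relation $R:\mathcal X\to\mathcal Y$ has an associated projection $P_R\in A_{\mathcal X,\mathcal Y}$, the unique projection with $$\Big\{a\in A_{\mathcal X,\mathcal Y} : \Big(\prod_{\alpha,\beta}R(X_\alpha,Y_\beta)\Big)a=\{0\}\Big\}=(1-P_R)A_{\mathcal X,\mathcal Y}.$$ **Proposition.** Let $\mathcal X,\mathcal Y,\mathcal Z,\mathcal W$ be quantum sets, $R:\mathcal X\to\mathcal Y$ a relation, and $\psi_r:\ell^\infty(\mathcal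 Y)\to\ell^\infty(\mathcal Z)$, $\psi_\ell:\ell^\infty(\mathcal X)\to\ell^\infty(\mathcal W)$ $W^*$-morphisms. Then the $W^*$-morphism $$\psi_\ell\mathbin{\overline\otimes}\psi_r:\ \ell^\infty(\mathcal X)\mathbin{\overline\otimes}\ell^\infty(\mathcal Y)^{op}\to\ell^\infty(\mathcal W)\mathbin{\overline\otimes}\ell^\infty(\mathcal Z)^{op}$$ satisfies $$(\psi_\ell\mathbin{\overline\otimes}\psi_r)(P_R)=P_{\hat\psi_r^\dagger\circ R\circ\hat\psi_\ell}.$$ -/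

import Mathlib

open scoped TensorProduct ENNReal Topology

set_option linter.checkUnivs false
set_option linter.unusedSectionVars false

noncomputable section

/-! ### Quantum sets, relations -/

/-- A quantum set: a family of finite-dimensional complex Hilbert spaces, its atoms. -/
structure QuantumSet.{u, v} where
  At : Type u
  H : At → Type v
  [instNormed : ∀ i, NormedAddCommGroup (H i)]
  [instInner : ∀ i, InnerProductSpace ℂ (H i)]
  [instFinDim : ∀ i, FiniteDimensional ℂ (H i)]

attribute [instance] QuantumSet.instNormed QuantumSet.instInner QuantumSet.instFinDim

namespace QuantumSet

instance instCompleteAtom (X : QuantumSet) (i : X.At) : CompleteSpace (X.H i) :=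
  FiniteDimensional.complete ℂ _

/-- `L(X_i, Y_j)`. -/
abbrev Hom (X Y : QuantumSet) (i : X.At) (j : Y.At) : Type _ := X.H i →L[ℂ] Y.H j

/-- `L(X_i)`. -/
abbrev End (X : QuantumSet) (i : X.At) : Type _ := X.H i →L[ℂ] X.H i

instance (X : QuantumSet) (i : X.At) : Ring (End X i) := inferInstance
instance (X : QuantumSet) (i : X.At) : StarRing (End X i) := inferInstance
instance (X : QuantumSet) (i : X.At) : Algebra ℂ (End X i) := inferInstance
instance (X : QuantumSet) (i : X.At) : StarModule ℂ (End X i) := inferInstance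
instance (X : QuantumSet) (i : X.At) : Star (End X i) := inferInstance
instance (X : QuantumSet) (i : X.At) : Semiring (End X i) := inferInstance
instance (X Y : QuantumSet) (i : X.At) (j : Y.At) : AddCommGroup (Hom X Y i j) := inferInstance
instance (X Y : QuantumSet) (i : X.At) (j : Y.At) : AddCommMonoid (Hom X Y i j) := inferInstance
instance (X Y : QuantumSet) (i : X.At) (j : Y.At) : Module ℂ (Hom X Y i j) := inferInstance

/-- The Hilbert space `H_X`, the `ℓ²`-direct sum of the atoms. -/
abbrev Hilb (X : QuantumSet) : Type _ := lp X.H 2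

/-- A relation from `X` to `Y`: a choice of subspaces `R(X_i, Y_j) ≤ L(X_i, Y_j)`. -/
abbrev Rel (X Y : QuantumSet) : Type _ := ∀ (i : X.At) (j : Y.At), Submodule ℂ (Hom X Y i j)

/-- Composition `S ∘ R` of relations: `(S ∘ R)(X_i, Z_k)` is the span of all `s ∘ r` with
`r ∈ R(X_i, Y_j)`, `s ∈ S(Y_j, Z_k)`, over all atoms `Y_j`. -/
def Rel.comp {X Y Z : QuantumSet} (S : Rel Y Z) (R : Rel X Y) : Rel X Z := fun i k =>
  Submodule.span ℂ {t | ∃ j, ∃ s ∈ S j k, ∃ r ∈ R i j, t = s ∘L r}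

/-- The dagger `R†(Y_j, X_i) = {r* : r ∈ R(X_i, Y_j)}`. -/
def Rel.dagger {X Y : QuantumSet} (R : Rel X Y) : Rel Y X := fun j i =>
  (R i j).map (ContinuousLinearMap.adjoint (𝕜 := ℂ) (E := X.H i) (F := Y.H j)).toLinearEquiv.toLinearMap

/-! ### The von Neumann algebra of a quantum set, and its morphisms -/

/-- `ℓ^∞(X)`: the bounded families `(a_i)` with `a_i ∈ L(X_i)`, with entrywise operations. -/
def Linf (X : QuantumSet) : StarSubalgebra ℂ (∀ i, End X i) where
  carrier := {a | ∃ C : ℝ, ∀ i, ‖a i‖ ≤ C}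
  mul_mem' := by
    rintro a b ⟨C, hC⟩ ⟨D, hD⟩
    refine ⟨C * D, fun i => (norm_mul_le _ _).trans ?_⟩
    exact mul_le_mul (hC i) (hD i) (norm_nonneg _) ((norm_nonneg _).trans (hC i))
  add_mem' := by
    rintro a b ⟨C, hC⟩ ⟨D, hD⟩
    exact ⟨C + D, fun i => (norm_add_le _ _).trans (add_le_add (hC i) (hD i))⟩
  algebraMap_mem' := by
    intro r
    refine ⟨‖r‖ * 1, fun i => ?_⟩
    rw [Pi.algebraMap_apply, Algebra.algebraMap_eq_smul_one]
    exact (norm_smul_le _ _).trans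
      (mul_le_mul_of_nonneg_left ContinuousLinearMap.norm_id_le (norm_nonneg _))
  star_mem' := by
    rintro a ⟨C, hC⟩
    exact ⟨C, fun i => by simpa using hC i⟩

instance (X : QuantumSet) : Ring X.Linf := inferInstance
instance (X : QuantumSet) : Algebra ℂ X.Linf := inferInstance
instance (X : QuantumSet) : StarRing X.Linf := inferInstance
instance (X : QuantumSet) : Semiring X.Linf := inferInstance
instance (X : QuantumSet) : Star X.Linf := inferInstance
instance (X : QuantumSet) : Mul X.Linf := inferInstance
instance (X : QuantumSet) : AddCommMonoid X.Linf := inferInstance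
instance (X : QuantumSet) : Module ℂ X.Linf := inferInstance

/-- The action of `ℓ^∞(X)` on `H_X` by block-diagonal operators. -/
def Linf.act {X : QuantumSet} (a : X.Linf) : Hilb X →L[ℂ] Hilb X :=
  lp.mapCLM 2 a.1 (K := max 0 a.2.choose) (le_max_left _ _)
    (fun i => (a.2.choose_spec i).trans (le_max_right _ _))

theorem Linf.act_apply {X : QuantumSet} (a : X.Linf) (v : Hilb X) (i : X.At) :
    Linf.act a v i = a.1 i (v i) := rfl

/-- The weak* topology of `ℓ^∞(X)`. The predual of this `ℓ^∞`-direct sum is the `ℓ¹`-direct sum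
of the duals `L(X_i)^*`, paired with `ℓ^∞(X)` by `⟨f, a⟩ = ∑_i f_i(a_i)`. -/
def Linf.weakStar (X : QuantumSet) : TopologicalSpace X.Linf :=
  ⨅ f : {f : ∀ i, StrongDual ℂ (End X i) // Summable fun i => ‖f i‖},
    TopologicalSpace.induced (fun a : X.Linf => ∑' i, f.1 i (a.1 i)) inferInstance

/-- `W*`-morphisms `ℓ^∞(Y) → ℓ^∞(X)`: unital, normal (i.e. weak*-continuous)
`*`-homomorphisms. -/
structure WMor (Y X : QuantumSet) where
  toHom : Y.Linf →⋆ₐ[ℂ] X.Linf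
  normal : Continuous[Linf.weakStar Y, Linf.weakStar X] toHom

/-- The space of bounded operators `T : H_X → H_Y` with `a T = T ψ(a)` for all
`a ∈ ℓ^∞(Y)`. -/
def WMor.intertwiners {X Y : QuantumSet} (ψ : WMor Y X) : Submodule ℂ (Hilb X →L[ℂ] Hilb Y) where
  carrier := {T | ∀ a : Y.Linf, Linf.act a ∘L T = T ∘L Linf.act (ψ.toHom a)}
  add_mem' := by
    intro S T hS hT a
    rw [ContinuousLinearMap.comp_add, ContinuousLinearMap.add_comp, hS a, hT a]
  zero_mem' := by intro a; simp
  smul_mem' := by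
    intro c T hT a
    rw [ContinuousLinearMap.comp_smul, ContinuousLinearMap.smul_comp, hT a]

/-- Compression of an operator `T : H_X → H_Y` to `id_{Y_j} T id_{X_i} : X_i → Y_j`. -/
def block {X Y : QuantumSet} (i : X.At) (j : Y.At) : (Hilb X →L[ℂ] Hilb Y) →ₗ[ℂ] Hom X Y i j where
  toFun T := by
    classical
    exact lp.evalCLM ℂ Y.H 2 j ∘L T ∘L lp.singleContinuousLinearMap ℂ X.H 2 i
  map_add' _ _ := by ext; simp
  map_smul' _ _ := by ext; simp

/-- The relation `ψ̂ : X → Y` of a `W*`-morphism `ψ : ℓ^∞(Y) → ℓ^∞(X)`. -/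
def WMor.rel {X Y : QuantumSet} (ψ : WMor Y X) : Rel X Y := fun i j =>
  ψ.intertwiners.map (block i j)

/-! ### The algebra `ℓ^∞(X) ⊗̄ ℓ^∞(Y)^op` -/

/-- `L(X_i) ⊗ L(Y_j)^op`, a `*`-algebra. -/
abbrev Blk (X Y : QuantumSet) (i : X.At) (j : Y.At) : Type _ :=
  End X i ⊗[ℂ] (End Y j)ᵐᵒᵖ

instance (X Y : QuantumSet) (i : X.At) (j : Y.At) : Ring (Blk X Y i j) := inferInstance
instance (X Y : QuantumSet) (i : X.At) (j : Y.At) : Algebra ℂ (Blk X Y i j) := inferInstance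
instance (X Y : QuantumSet) (i : X.At) (j : Y.At) : StarRing (Blk X Y i j) := inferInstance
instance (X Y : QuantumSet) (i : X.At) (j : Y.At) : StarModule ℂ (Blk X Y i j) := inferInstance
instance (X Y : QuantumSet) (i : X.At) (j : Y.At) : Star (Blk X Y i j) := inferInstance
instance (X Y : QuantumSet) (i : X.At) (j : Y.At) : Mul (Blk X Y i j) := inferInstance
instance (X Y : QuantumSet) (i : X.At) (j : Y.At) : Semiring (Blk X Y i j) := inferInstance
instance (X Y : QuantumSet) (i : X.At) (j : Y.At) : AddCommGroup (Blk X Y i j) := inferInstance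
instance (X Y : QuantumSet) (i : X.At) (j : Y.At) : AddCommMonoid (Blk X Y i j) := inferInstance
instance (X Y : QuantumSet) (i : X.At) (j : Y.At) : Module ℂ (Blk X Y i j) := inferInstance

/-- Sums of elements `s* s`. -/
def posCone (B : Type*) [Ring B] [StarRing B] : AddSubmonoid B :=
  AddSubmonoid.closure (Set.range fun s : B => star s * s)

section Cone

variable {B : Type*} [Ring B] [StarRing B]

theorem star_mul_mem_posCone (s : B) : star s * s ∈ posCone B :=
  AddSubmonoid.subset_closure ⟨s, rfl⟩

theorem conj_mem_posCone (n : B) {p : B} (hp : p ∈ posCone B) : star n * p * n ∈ posCone B := by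
  induction hp using AddSubmonoid.closure_induction with
  | mem x hx =>
    obtain ⟨s, rfl⟩ := hx
    have := star_mul_mem_posCone (s * n)
    rwa [star_mul, mul_assoc, ← mul_assoc (star s), ← mul_assoc (star n)] at this
  | zero => simp
  | add x y _ _ hx hy => rw [mul_add, add_mul]; exact add_mem hx hy

theorem smul_mem_posCone [Algebra ℂ B] [StarModule ℂ B] {r : ℝ} (hr : 0 ≤ r) {p : B}
    (hp : p ∈ posCone B) : (r : ℂ) • p ∈ posCone B := by
  have := conj_mem_posCone (((Real.sqrt r : ℝ) : ℂ) • (1 : B)) hp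
  simp only [star_smul, star_one, smul_mul_assoc, one_mul, mul_smul_comm, mul_one, smul_smul,
    RCLike.star_def, Complex.conj_ofReal] at this
  rwa [← Complex.ofReal_mul, Real.mul_self_sqrt hr] at this

end Cone

/-- `StarBdd K b` says `b* b ≤ K • 1`. In a finite-dimensional C*-algebra this means
`‖b‖² ≤ K` for the (unique) C*-norm. -/
def StarBdd {B : Type*} [Ring B] [StarRing B] [Algebra ℂ B] (K : ℝ) (b : B) : Prop :=
  (K : ℂ) • (1 : B) - star b * b ∈ posCone B

section StarBdd

variable {B : Type*} [Ring B] [StarRing B] [Algebra ℂ B] [StarModule ℂ B]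

theorem StarBdd.mul {K L : ℝ} (hK : 0 ≤ K) {a b : B} (ha : StarBdd K a) (hb : StarBdd L b) :
    StarBdd (K * L) (a * b) := by
  have h1 := conj_mem_posCone b ha
  have h2 := smul_mem_posCone hK hb
  have h3 := add_mem h1 h2
  unfold StarBdd
  convert h3 using 1
  simp only [star_mul, mul_sub, sub_mul, smul_sub, smul_smul, Complex.ofReal_mul, mul_smul_comm,
    mul_one, smul_mul_assoc, mul_assoc]
  abel

theorem StarBdd.add {K L : ℝ} {a b : B} (ha : StarBdd K a) (hb : StarBdd L b) :
    StarBdd (2 * K + 2 * L) (a + b) := by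
  have h1 := add_mem (add_mem ha ha) (add_mem hb hb)
  have h3 := add_mem h1 (star_mul_mem_posCone (a - b))
  unfold StarBdd
  convert h3 using 1
  simp only [star_add, star_sub, mul_sub, sub_mul, mul_add, add_mul,
    Complex.ofReal_add, two_mul, add_smul]
  abel

theorem StarBdd.star {K : ℝ} (hK : 0 < K) {a : B} (ha : StarBdd K a) : StarBdd K (star a) := by
  have h1 := star_mul_mem_posCone ((K : ℂ) • (1 : B) - a * Star.star a)
  have h2 := conj_mem_posCone (Star.star a) ha
  have h3 := smul_mem_posCone (inv_pos.2 hK).le (add_mem h1 h2)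
  unfold StarBdd
  convert h3 using 1
  have hK' : (K : ℂ) ≠ 0 := by exact_mod_cast hK.ne'
  rw [Complex.ofReal_inv, eq_inv_smul_iff₀ hK']
  simp only [star_sub, star_mul, star_star, star_smul, star_one, RCLike.star_def,
    Complex.conj_ofReal, mul_sub, sub_mul, smul_sub, smul_smul, mul_smul_comm,
    mul_one, one_mul, smul_mul_assoc, mul_assoc]
  abel

theorem StarBdd.mono {K L : ℝ} (h : K ≤ L) {a : B} (ha : StarBdd K a) : StarBdd L a := by
  have h1 : (1 : B) ∈ posCone B := by simpa using star_mul_mem_posCone (1 : B)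
  have h2 := add_mem ha (smul_mem_posCone (sub_nonneg.2 h) h1)
  unfold StarBdd
  convert h2 using 1
  rw [Complex.ofReal_sub, sub_smul]
  abel

theorem StarBdd.algebraMap (c : ℂ) : StarBdd (Complex.normSq c) (algebraMap ℂ B c) := by
  unfold StarBdd
  rw [← algebraMap_star_comm, ← map_mul, RCLike.star_def, ← Complex.normSq_eq_conj_mul_self,
    Algebra.algebraMap_eq_smul_one, sub_self]
  exact zero_mem _

theorem starBdd_of_isStarProjection {p : B} (hp : IsStarProjection p) : StarBdd 1 p := by
  unfold StarBdd
  rw [hp.isSelfAdjoint.star_eq, hp.isIdempotentElem.eq, Complex.ofReal_one, one_smul]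
  have h := star_mul_mem_posCone (1 - p)
  rwa [hp.one_sub.isSelfAdjoint.star_eq, hp.one_sub.isIdempotentElem.eq] at h

end StarBdd

section BddProd

variable {ι κ : Type*} (B : ι → Type*) [∀ i, Ring (B i)] [∀ i, StarRing (B i)]
  [∀ i, Algebra ℂ (B i)] [∀ i, StarModule ℂ (B i)] {C : κ → Type*} [∀ i, Ring (C i)]
  [∀ i, StarRing (C i)] [∀ i, Algebra ℂ (C i)] [∀ i, StarModule ℂ (C i)]

/-- The `W*`-product of a family of finite-dimensional C*-algebras: the families that are bounded in
C*-norm, with entrywise operations. -/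
def bddProd : StarSubalgebra ℂ (∀ i, B i) where
  carrier := {m | ∃ K : ℝ, 0 < K ∧ ∀ i, StarBdd K (m i)}
  mul_mem' := by
    rintro a b ⟨K, hK, ha⟩ ⟨L, hL, hb⟩
    exact ⟨K * L, mul_pos hK hL, fun p => (ha p).mul hK.le (hb p)⟩
  add_mem' := by
    rintro a b ⟨K, hK, ha⟩ ⟨L, hL, hb⟩
    exact ⟨2 * K + 2 * L, by positivity, fun p => (ha p).add (hb p)⟩
  algebraMap_mem' := by
    intro r
    refine ⟨Complex.normSq r + 1, by have := Complex.normSq_nonneg r; positivity, fun p => ?_⟩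
    exact (StarBdd.algebraMap r).mono (by linarith)
  star_mem' := by
    rintro a ⟨K, hK, ha⟩
    exact ⟨K, hK, fun p => (ha p).star hK⟩

instance : Ring (bddProd B) := inferInstance
instance : Semiring (bddProd B) := inferInstance
instance : Algebra ℂ (bddProd B) := inferInstance
instance : StarRing (bddProd B) := inferInstance
instance : Star (bddProd B) := inferInstance
instance : Mul (bddProd B) := inferInstance
instance : One (bddProd B) := inferInstance
instance : Sub (bddProd B) := inferInstance

variable {B}

/-- Restriction of a norm-decreasing `*`-homomorphism of full products to bounded families. -/
def bddProd.map (F : (∀ i, B i) →⋆ₐ[ℂ] (∀ j, C j))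
    (hF : ∀ K m, (∀ i, StarBdd K (m i)) → ∀ j, StarBdd K (F m j)) : bddProd B →⋆ₐ[ℂ] bddProd C :=
  (F.comp (bddProd B).subtype).codRestrict (bddProd C) fun m =>
    ⟨m.2.choose, m.2.choose_spec.1, hF _ _ m.2.choose_spec.2⟩

theorem bddProd.existsUnique_proj (S : Set (bddProd B)) (P : ∀ i, B i)
    (hP : ∀ i, IsStarProjection (P i)) (hS : ∀ a, a ∈ S ↔ ∀ i, P i * a.1 i = 0) :
    ∃! Q : bddProd B, IsStarProjection Q ∧ S = {a | ∃ b, a = (1 - Q) * b} := by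
  let Q : bddProd B := ⟨P, 1, one_pos, fun p => starBdd_of_isStarProjection (hP p)⟩
  have hQ : IsStarProjection Q :=
    ⟨Subtype.ext (funext fun p => (hP p).isIdempotentElem),
      Subtype.ext (funext fun p => (hP p).isSelfAdjoint)⟩
  have hS' : ∀ a, a ∈ S ↔ Q * a = 0 := fun a => by
    rw [hS, Subtype.ext_iff, funext_iff]
    rfl
  have hQA : S = {a | ∃ b, a = (1 - Q) * b} := by
    ext a
    rw [hS']
    constructor
    · intro h
      exact ⟨a, by rw [sub_mul, one_mul, h, sub_zero]⟩
    · rintro ⟨b, rfl⟩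
      rw [← mul_assoc, mul_sub, mul_one, hQ.isIdempotentElem.eq, sub_self, zero_mul]
  refine ⟨Q, ⟨hQ, hQA⟩, ?_⟩
  rintro P' ⟨hP', hA'⟩
  have h1 : Q * P' = Q := by
    have hm : (1 - P') ∈ S := by rw [hA']; exact ⟨1, (mul_one _).symm⟩
    rw [hS', mul_sub, mul_one, sub_eq_zero] at hm
    exact hm.symm
  have h2 : P' * Q = P' := by
    have hm : (1 - Q) ∈ S := by rw [hQA]; exact ⟨1, (mul_one _).symm⟩
    rw [hA'] at hm
    obtain ⟨b, hb⟩ := hm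
    have h : P' * (1 - Q) = 0 := by
      rw [hb, ← mul_assoc, mul_sub, mul_one, hP'.isIdempotentElem.eq, sub_self, zero_mul]
    rw [mul_sub, mul_one, sub_eq_zero] at h
    exact h.symm
  calc P' = star P' := hP'.isSelfAdjoint.star_eq.symm
    _ = star (P' * Q) := by rw [h2]
    _ = Q * P' := by rw [star_mul, hP'.isSelfAdjoint.star_eq, hQ.isSelfAdjoint.star_eq]
    _ = Q := h1

end BddProd

/-- `ℓ^∞(X) ⊗̄ ℓ^∞(Y)^op`, i.e. the `W*`-product of the algebras `L(X_i) ⊗ L(Y_j)^op`. -/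
abbrev LinfTensor (X Y : QuantumSet) : StarSubalgebra ℂ (∀ p : X.At × Y.At, Blk X Y p.1 p.2) :=
  bddProd fun p : X.At × Y.At => Blk X Y p.1 p.2

/-- The right action of `L(X_i) ⊗ L(Y_j)^op` on `L(X_i, Y_j)`: `x (a ⊗ b) = b x a`. -/
def blkAct {X Y : QuantumSet} {i : X.At} {j : Y.At} (x : Hom X Y i j) :
    Blk X Y i j →ₗ[ℂ] Hom X Y i j :=
  TensorProduct.lift <| LinearMap.mk₂ ℂ (fun a b => b.unop ∘L x ∘L a)
    (fun _ _ _ => by ext; simp) (fun _ _ _ => by ext; simp)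
    (fun _ _ _ => by ext; simp) (fun _ _ _ => by ext; simp)

@[simp] theorem blkAct_tmul {X Y : QuantumSet} {i : X.At} {j : Y.At} (x : Hom X Y i j)
    (a : End X i) (b : (End Y j)ᵐᵒᵖ) : blkAct x (a ⊗ₜ b) = b.unop ∘L x ∘L a := rfl

/-- The annihilator of `∏ R(X_i, Y_j)` in `ℓ^∞(X) ⊗̄ ℓ^∞(Y)^op`, for the entrywise right action. -/
def Rel.ann {X Y : QuantumSet} (R : Rel X Y) : Set (LinfTensor X Y) :=
  {a | ∀ x : (∀ p : X.At × Y.At, Hom X Y p.1 p.2), (∀ p, x p ∈ R p.1 p.2) →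
    (fun p => blkAct (x p) (a.1 p)) = 0}

/-! ### The tensor product of two `W*`-morphisms -/

/-- The element of `ℓ^∞(X)` with entry `a` at `i` and zero elsewhere. -/
def Linf.single {X : QuantumSet} (i : X.At) : End X i →ₗ[ℂ] X.Linf where
  toFun a := by
    classical
    exact ⟨Pi.single i a, ‖a‖, fun k => by
      rcases eq_or_ne k i with rfl | h
      · simp
      · simp [h]⟩
  map_add' a b := by ext1; simp [Pi.single_add]
  map_smul' c a := by ext1; simp [Pi.single_smul]

section Single

variable {X : QuantumSet}

theorem Linf.single_val [DecidableEq X.At] (i : X.At) (a : End X i) :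
    (Linf.single i a).1 = Pi.single i a := by
  simp only [Linf.single, LinearMap.coe_mk, AddHom.coe_mk]
  congr!

theorem Linf.mul_single (b : X.Linf) (i : X.At) (a : End X i) :
    b * Linf.single i a = Linf.single i (b.1 i * a) := by
  classical
  ext1
  funext k
  change b.1 k * (Linf.single i a).1 k = (Linf.single i (b.1 i * a)).1 k
  rw [Linf.single_val, Linf.single_val]
  rcases eq_or_ne k i with rfl | h
  · simp
  · simp [h]

theorem Linf.single_mul_single (i : X.At) (a b : End X i) :
    Linf.single i a * Linf.single i b = Linf.single i (a * b) := by
  classical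
  rw [Linf.mul_single, Linf.single_val, Pi.single_eq_same]

theorem Linf.single_mul_single_ne {i k : X.At} (h : i ≠ k) (a : End X i) (b : End X k) :
    Linf.single i a * Linf.single k b = 0 := by
  classical
  rw [Linf.mul_single, Linf.single_val, Pi.single_eq_of_ne h.symm, zero_mul, map_zero]

theorem Linf.star_single (i : X.At) (a : End X i) :
    star (Linf.single i a) = Linf.single i (star a) := by
  classical
  ext1
  funext k
  change star ((Linf.single i a).1 k) = (Linf.single i (star a)).1 k
  rw [Linf.single_val, Linf.single_val]
  rcases eq_or_ne k i with rfl | h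
  · simp
  · simp [h]

end Single

/-- The corner `L(X_i) → L(W_w)` of a `W*`-morphism `ψ : ℓ^∞(X) → ℓ^∞(W)`. -/
def WMor.corner {X W : QuantumSet} (ψ : WMor X W) (i : X.At) (w : W.At) : End X i →ₗ[ℂ] End W w where
  toFun a := (ψ.toHom (Linf.single i a)).1 w
  map_add' a b := by
    have h : ψ.toHom (Linf.single i (a + b)) = ψ.toHom (Linf.single i a) + ψ.toHom (Linf.single i b) := by
      rw [map_add]; exact map_add ψ.toHom.toAlgHom _ _
    rw [h]; rfl
  map_smul' c a := by
    have h : ψ.toHom (Linf.single i (c • a)) = c • ψ.toHom (Linf.single i a) := by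
      rw [map_smul]; exact map_smul ψ.toHom.toAlgHom _ _
    rw [h]; rfl

section Corner

variable {X W : QuantumSet} (ψ : WMor X W)

theorem WMor.corner_apply (i : X.At) (w : W.At) (a : End X i) :
    ψ.corner i w a = (ψ.toHom (Linf.single i a)).1 w := rfl

theorem WMor.corner_mul (i : X.At) (w : W.At) (a b : End X i) :
    ψ.corner i w (a * b) = ψ.corner i w a * ψ.corner i w b := by
  rw [ψ.corner_apply, ← Linf.single_mul_single, map_mul]
  rfl

theorem WMor.corner_mul_ne {i k : X.At} (h : i ≠ k) (w : W.At) (a : End X i) (b : End X k) :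
    ψ.corner i w a * ψ.corner k w b = 0 := by
  have := congrArg (fun t => (ψ.toHom t).1 w) (Linf.single_mul_single_ne h a b)
  simp only [map_mul, map_zero] at this
  exact this

theorem WMor.corner_star (i : X.At) (w : W.At) (a : End X i) :
    ψ.corner i w (star a) = star (ψ.corner i w a) := by
  rw [ψ.corner_apply, ← Linf.star_single, map_star]
  rfl

theorem WMor.finite_corner (w : W.At) : {i | ψ.corner i w 1 ≠ 0}.Finite := by
  have hli : LinearIndependent ℂ (fun i : {i | ψ.corner i w 1 ≠ 0} => ψ.corner i.1 w 1) := by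
    rw [linearIndependent_iff']
    intro s g hg k hk
    have h := congrArg (fun t => t * ψ.corner k.1 w 1) hg
    simp only [Finset.sum_mul, zero_mul, smul_mul_assoc] at h
    rw [Finset.sum_eq_single k] at h
    · rw [← ψ.corner_mul, mul_one] at h
      exact (smul_eq_zero.1 h).resolve_right k.2
    · intro b _ hb
      rw [ψ.corner_mul_ne (fun e => hb (Subtype.ext e)), smul_zero]
    · exact fun h => absurd hk h
  have := hli.finite
  exact Set.toFinite _

/-- The finitely many atoms `X_i` on which the component `ℓ^∞(X) → L(W_w)` of `ψ` is nonzero. -/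
def WMor.supp (w : W.At) : Finset X.At := (ψ.finite_corner w).toFinset

theorem WMor.corner_eq_zero {i : X.At} {w : W.At} (h : i ∉ ψ.supp w) (a : End X i) :
    ψ.corner i w a = 0 := by
  have h1 : ψ.corner i w 1 = 0 := by simpa [WMor.supp] using h
  rw [← mul_one a, ψ.corner_mul, h1, mul_zero]

/-- The finite partial sums of the units of the atoms converge weak* to the unit. -/
theorem Linf.tendsto_one (X : QuantumSet) :
    Filter.Tendsto (fun s : Finset X.At => ∑ i ∈ s, Linf.single i (1 : End X i)) Filter.atTop
      (@nhds _ (Linf.weakStar X) 1) := by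
  classical
  rw [Linf.weakStar, nhds_iInf, Filter.tendsto_iInf]
  rintro ⟨f, hf⟩
  rw [nhds_induced, Filter.tendsto_comap_iff]
  have hsum : Summable fun i => f i (1 : End X i) := by
    refine Summable.of_norm_bounded hf fun i => ?_
    calc ‖f i 1‖ ≤ ‖f i‖ * ‖(1 : End X i)‖ := (f i).le_opNorm _
      _ ≤ ‖f i‖ * 1 := mul_le_mul_of_nonneg_left ContinuousLinearMap.norm_id_le (norm_nonneg _)
      _ = ‖f i‖ := mul_one _
  have h := hsum.hasSum
  refine Filter.Tendsto.congr (fun s => ?_) h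
  have hv : ∀ k, (∑ i ∈ s, Linf.single i (1 : End X i)).1 k = if k ∈ s then 1 else 0 := by
    intro k
    rw [AddSubmonoidClass.coe_finsetSum, Finset.sum_apply]
    simp only [Linf.single_val]
    split_ifs with hk
    · rw [Finset.sum_eq_single k]
      · simp
      · intro b _ hb; simp [hb.symm]
      · exact fun h => absurd hk h
    · refine Finset.sum_eq_zero fun b hb => ?_
      have : k ≠ b := fun e => hk (e ▸ hb)
      simp [this]
  simp only [Function.comp]
  rw [tsum_eq_sum (s := s)]
  · refine Finset.sum_congr rfl fun i hi => ?_
    rw [hv, if_pos hi]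
  · intro b hb
    rw [hv, if_neg hb, map_zero]

theorem Linf.continuous_apply (w : W.At) (g : StrongDual ℂ (End W w)) :
    @Continuous _ _ (Linf.weakStar W) _ (fun a : W.Linf => g (a.1 w)) := by
  classical
  have hs : Summable fun i => ‖(Pi.single w g : ∀ i, StrongDual ℂ (End W i)) i‖ :=
    summable_of_ne_finset_zero (s := {w}) fun b hb => by
      have : b ≠ w := by simpa using hb
      simp [this]
  have h : @Continuous _ _ (Linf.weakStar W) _ (fun a : W.Linf =>
      ∑' i, (Pi.single w g : ∀ i, StrongDual ℂ (End W i)) i (a.1 i)) := by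
    refine continuous_iff_le_induced.2 ?_
    exact iInf_le (fun f : {f : ∀ i, StrongDual ℂ (End W i) // Summable fun i => ‖f i‖} =>
      TopologicalSpace.induced (fun a : W.Linf => ∑' i, f.1 i (a.1 i)) inferInstance)
      ⟨Pi.single w g, hs⟩
  have e : (fun a : W.Linf => g (a.1 w)) = (fun a : W.Linf =>
      ∑' i, (Pi.single w g : ∀ i, StrongDual ℂ (End W i)) i (a.1 i)) := by
    funext a
    rw [tsum_eq_single w]
    · simp
    · intro b hb
      simp [hb]
  rw [e]
  exact h

theorem WMor.sum_corner_one (w : W.At) : ∑ i ∈ ψ.supp w, ψ.corner i w 1 = 1 := by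
  let _ := Linf.weakStar X
  let _ := Linf.weakStar W
  rw [← sub_eq_zero]
  refine (SeparatingDual.eq_zero_iff_forall_dual_eq_zero (R := ℂ) _).2 fun g => ?_
  rw [map_sub, sub_eq_zero]
  have h := (((Linf.continuous_apply w g).comp ψ.normal).tendsto 1).comp (Linf.tendsto_one X)
  have h2 : Filter.Tendsto (fun s : Finset X.At => g (∑ i ∈ ψ.supp w, ψ.corner i w 1))
      Filter.atTop (𝓝 (g 1)) := by
    have e : ((fun a : W.Linf => g (a.1 w)) ∘ ψ.toHom) 1 = g 1 := by simp
    rw [e] at h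
    refine h.congr' ?_
    filter_upwards [Filter.eventually_ge_atTop (ψ.supp w)] with s hs
    simp only [Function.comp, map_sum, AddSubmonoidClass.coe_finsetSum, Finset.sum_apply]
    symm
    refine Finset.sum_subset hs fun i _ hi => ?_
    rw [ψ.corner_eq_zero hi 1, map_zero]
  exact tendsto_nhds_unique tendsto_const_nhds h2

end Corner

/-- The entry `L(X_i) ⊗ L(Y_j)^op → L(W_w) ⊗ L(Z_z)^op` of `ψ_ℓ ⊗̄ ψ_r`, the tensor product of the
corners of `ψ_ℓ` and of `ψ_r`. -/
def WMor.tensorCorner {X Y Z W : QuantumSet} (ψl : WMor X W) (ψr : WMor Y Z)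
    (p : X.At × Y.At) (q : W.At × Z.At) : Blk X Y p.1 p.2 →ₗ[ℂ] Blk W Z q.1 q.2 :=
  TensorProduct.map (ψl.corner p.1 q.1)
    ((MulOpposite.opLinearEquiv ℂ).toLinearMap ∘ₗ ψr.corner p.2 q.2 ∘ₗ
      (MulOpposite.opLinearEquiv ℂ).symm.toLinearMap)

section TensorCorner

theorem sum_tmul_sum {M N ι κ : Type*} [AddCommGroup M] [Module ℂ M] [AddCommGroup N] [Module ℂ N]
    (s : Finset ι) (t : Finset κ) (f : ι → M) (g : κ → N) :
    ∑ p ∈ s ×ˢ t, f p.1 ⊗ₜ[ℂ] g p.2 = (∑ i ∈ s, f i) ⊗ₜ[ℂ] (∑ j ∈ t, g j) := by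
  rw [Finset.sum_product, TensorProduct.sum_tmul]
  refine Finset.sum_congr rfl fun i _ => ?_
  rw [TensorProduct.tmul_sum]

variable {X Y Z W : QuantumSet} (ψl : WMor X W) (ψr : WMor Y Z)

theorem WMor.tensorCorner_tmul (p : X.At × Y.At) (q : W.At × Z.At) (a : End X p.1)
    (b : (End Y p.2)ᵐᵒᵖ) : ψl.tensorCorner ψr p q (a ⊗ₜ b) =
      ψl.corner p.1 q.1 a ⊗ₜ MulOpposite.op (ψr.corner p.2 q.2 b.unop) := rfl

theorem WMor.tensorCorner_mul (p : X.At × Y.At) (q : W.At × Z.At) (m n : Blk X Y p.1 p.2) :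
    ψl.tensorCorner ψr p q (m * n) = ψl.tensorCorner ψr p q m * ψl.tensorCorner ψr p q n := by
  induction m using TensorProduct.induction_on with
  | zero => simp
  | add x y hx hy => rw [add_mul, map_add, map_add, add_mul, hx, hy]
  | tmul a b =>
    induction n using TensorProduct.induction_on with
    | zero => simp
    | add x y hx hy => rw [mul_add, map_add, map_add, mul_add, hx, hy]
    | tmul c d =>
      rw [Algebra.TensorProduct.tmul_mul_tmul]
      simp only [tensorCorner_tmul]
      rw [Algebra.TensorProduct.tmul_mul_tmul, MulOpposite.unop_mul, corner_mul, corner_mul,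
        MulOpposite.op_mul]

theorem WMor.tensorCorner_mul_ne {p p' : X.At × Y.At} (h : p ≠ p') (q : W.At × Z.At)
    (m : Blk X Y p.1 p.2) (n : Blk X Y p'.1 p'.2) :
    ψl.tensorCorner ψr p q m * ψl.tensorCorner ψr p' q n = 0 := by
  induction m using TensorProduct.induction_on with
  | zero => simp
  | add x y hx hy => rw [map_add, add_mul, hx, hy, add_zero]
  | tmul a b =>
    induction n using TensorProduct.induction_on with
    | zero => simp
    | add x y hx hy => rw [map_add, mul_add, hx, hy, add_zero]
    | tmul c d =>
      simp only [tensorCorner_tmul]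
      rw [Algebra.TensorProduct.tmul_mul_tmul, ← MulOpposite.op_mul]
      by_cases h1 : p.1 = p'.1
      · have h2 : p'.2 ≠ p.2 := fun e => h (Prod.ext h1 e.symm)
        rw [corner_mul_ne _ h2, MulOpposite.op_zero, TensorProduct.tmul_zero]
      · rw [corner_mul_ne _ h1, TensorProduct.zero_tmul]

theorem WMor.tensorCorner_star (p : X.At × Y.At) (q : W.At × Z.At) (m : Blk X Y p.1 p.2) :
    ψl.tensorCorner ψr p q (star m) = star (ψl.tensorCorner ψr p q m) := by
  induction m using TensorProduct.induction_on with
  | zero => simp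
  | add x y hx hy => rw [star_add, map_add, map_add, star_add, hx, hy]
  | tmul a b =>
    rw [TensorProduct.star_tmul, tensorCorner_tmul, tensorCorner_tmul, TensorProduct.star_tmul,
      MulOpposite.unop_star, corner_star, corner_star, MulOpposite.op_star]

theorem WMor.tensorCorner_posCone (p : X.At × Y.At) (q : W.At × Z.At) {m : Blk X Y p.1 p.2}
    (hm : m ∈ posCone (Blk X Y p.1 p.2)) :
    ψl.tensorCorner ψr p q m ∈ posCone (Blk W Z q.1 q.2) := by
  induction hm using AddSubmonoid.closure_induction with
  | mem x hx =>
    obtain ⟨s, rfl⟩ := hx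
    simp only
    rw [tensorCorner_mul, tensorCorner_star]
    exact star_mul_mem_posCone _
  | zero => rw [map_zero]; exact zero_mem _
  | add x y _ _ hx hy => rw [map_add]; exact add_mem hx hy

/-- The component of `ψ_ℓ ⊗̄ ψ_r` at the atom `(W_w, Z_z)`. -/
def WMor.tensorFun (q : W.At × Z.At) :
    (∀ p : X.At × Y.At, Blk X Y p.1 p.2) →ₗ[ℂ] Blk W Z q.1 q.2 where
  toFun m := ∑ p ∈ ψl.supp q.1 ×ˢ ψr.supp q.2, ψl.tensorCorner ψr p q (m p)
  map_add' m n := by simp only [Pi.add_apply, map_add, Finset.sum_add_distrib]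
  map_smul' c m := by simp only [Pi.smul_apply, map_smul, Finset.smul_sum, RingHom.id_apply]

theorem WMor.tensorFun_apply (q : W.At × Z.At) (m : ∀ p : X.At × Y.At, Blk X Y p.1 p.2) :
    ψl.tensorFun ψr q m = ∑ p ∈ ψl.supp q.1 ×ˢ ψr.supp q.2, ψl.tensorCorner ψr p q (m p) := rfl

theorem WMor.tensorFun_one (q : W.At × Z.At) : ψl.tensorFun ψr q 1 = 1 := by
  change ∑ p ∈ ψl.supp q.1 ×ˢ ψr.supp q.2,
    ψl.corner p.1 q.1 1 ⊗ₜ[ℂ] MulOpposite.op (ψr.corner p.2 q.2 1) = _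
  rw [sum_tmul_sum (ψl.supp q.1) (ψr.supp q.2) (fun i => ψl.corner i q.1 1)
    (fun j => MulOpposite.op (ψr.corner j q.2 1)), ψl.sum_corner_one, ← Finset.op_sum, ψr.sum_corner_one,
    MulOpposite.op_one, Algebra.TensorProduct.one_def]

theorem WMor.tensorFun_mul (q : W.At × Z.At) (m n : ∀ p : X.At × Y.At, Blk X Y p.1 p.2) :
    ψl.tensorFun ψr q (m * n) = ψl.tensorFun ψr q m * ψl.tensorFun ψr q n := by
  simp only [tensorFun_apply, Finset.sum_mul_sum]
  refine Finset.sum_congr rfl fun p hp => ?_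
  rw [Finset.sum_eq_single p]
  · rw [Pi.mul_apply, tensorCorner_mul]
  · exact fun p' _ h => tensorCorner_mul_ne ψl ψr h.symm q _ _
  · exact fun h => absurd hp h

theorem WMor.tensorFun_star (q : W.At × Z.At) (m : ∀ p : X.At × Y.At, Blk X Y p.1 p.2) :
    ψl.tensorFun ψr q (star m) = star (ψl.tensorFun ψr q m) := by
  simp only [tensorFun_apply, star_sum, Pi.star_apply, tensorCorner_star]

theorem WMor.tensorFun_starBdd {K : ℝ} {m : ∀ p : X.At × Y.At, Blk X Y p.1 p.2}
    (hm : ∀ p, StarBdd K (m p)) (q : W.At × Z.At) : StarBdd K (ψl.tensorFun ψr q m) := by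
  unfold StarBdd
  rw [← tensorFun_star, ← tensorFun_mul, ← ψl.tensorFun_one ψr, ← map_smul, ← map_sub,
    tensorFun_apply]
  exact sum_mem fun p _ => tensorCorner_posCone ψl ψr p q (hm p)

/-- `ψ_ℓ ⊗̄ ψ_r` on arbitrary families. -/
def WMor.tensorPi : (∀ p : X.At × Y.At, Blk X Y p.1 p.2) →⋆ₐ[ℂ]
    (∀ q : W.At × Z.At, Blk W Z q.1 q.2) where
  toFun m q := ψl.tensorFun ψr q m
  map_one' := funext fun q => ψl.tensorFun_one ψr q
  map_mul' m n := funext fun q => ψl.tensorFun_mul ψr q m n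
  map_zero' := funext fun q => LinearMap.map_zero (ψl.tensorFun ψr q)
  map_add' m n := funext fun q => LinearMap.map_add (ψl.tensorFun ψr q) m n
  commutes' c := funext fun q => by
    rw [Pi.algebraMap_apply, Algebra.algebraMap_eq_smul_one, Algebra.algebraMap_eq_smul_one,
      LinearMap.map_smul, tensorFun_one]
  map_star' m := funext fun q => ψl.tensorFun_star ψr q m

/-- The tensor product `ψ_ℓ ⊗̄ ψ_r : ℓ^∞(X) ⊗̄ ℓ^∞(Y)^op → ℓ^∞(W) ⊗̄ ℓ^∞(Z)^op` of `W*`-morphisms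
`ψ_ℓ : ℓ^∞(X) → ℓ^∞(W)` and `ψ_r : ℓ^∞(Y) → ℓ^∞(Z)`; it maps `a ⊗ b` to `ψ_ℓ(a) ⊗ ψ_r(b)`.
By normality, each component of `ψ_ℓ` and `ψ_r` is nonzero on finitely many atoms only, so that each
component of the tensor product is a finite sum of tensor products of corners. -/
def WMor.tensor : LinfTensor X Y →⋆ₐ[ℂ] LinfTensor W Z :=
  bddProd.map (ψl.tensorPi ψr) fun _ _ hm => ψl.tensorFun_starBdd ψr hm

theorem WMor.tensor_val (m : LinfTensor X Y) (q : W.At × Z.At) :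
    (ψl.tensor ψr m).1 q = ψl.tensorFun ψr q m.1 := rfl

end TensorCorner

section Tmul

theorem starBdd_of_norm_le {X : QuantumSet} {i : X.At} {a : End X i} {C : ℝ} (h : ‖a‖ ≤ C) :
    StarBdd (C ^ 2) a := by
  have h1 : StarBdd (‖a‖ ^ 2) a := by
    have h2 := CStarAlgebra.star_mul_le_algebraMap_norm_sq (a := a)
    rw [← sub_nonneg, StarOrderedRing.nonneg_iff] at h2
    unfold StarBdd
    rw [Algebra.algebraMap_eq_smul_one] at h2
    exact h2
  exact h1.mono (pow_le_pow_left₀ (norm_nonneg _) h 2)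

theorem starBdd_tmul {X Y : QuantumSet} {i : X.At} {j : Y.At} {a : End X i} {b : End Y j} {C D : ℝ}
    (ha : ‖a‖ ≤ C) (hb : ‖b‖ ≤ D) :
    StarBdd (C ^ 2 * D ^ 2) (a ⊗ₜ[ℂ] MulOpposite.op b : Blk X Y i j) := by
  have h1 : StarBdd (C ^ 2) (a ⊗ₜ[ℂ] 1 : Blk X Y i j) := by
    have := starBdd_of_norm_le ha
    unfold StarBdd at this ⊢
    have key : ∀ p ∈ posCone (End X i), (p ⊗ₜ[ℂ] 1 : Blk X Y i j) ∈ posCone (Blk X Y i j) := by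
      intro p hp
      induction hp using AddSubmonoid.closure_induction with
      | mem x hx =>
        obtain ⟨s, rfl⟩ := hx
        have := star_mul_mem_posCone (s ⊗ₜ[ℂ] 1 : Blk X Y i j)
        rwa [TensorProduct.star_tmul, star_one, Algebra.TensorProduct.tmul_mul_tmul, one_mul] at this
      | zero => rw [TensorProduct.zero_tmul]; exact zero_mem _
      | add x y _ _ hx hy => rw [TensorProduct.add_tmul]; exact add_mem hx hy
    rw [TensorProduct.star_tmul, star_one, Algebra.TensorProduct.tmul_mul_tmul, one_mul,
      Algebra.TensorProduct.one_def, TensorProduct.smul_tmul', ← TensorProduct.sub_tmul]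
    exact key _ this
  have h2 : StarBdd (D ^ 2) (1 ⊗ₜ[ℂ] MulOpposite.op b : Blk X Y i j) := by
    have := starBdd_of_norm_le (a := star b) (C := D) (by rwa [norm_star])
    unfold StarBdd at this ⊢
    have key : ∀ p ∈ posCone (End Y j),
        (1 ⊗ₜ[ℂ] MulOpposite.op p : Blk X Y i j) ∈ posCone (Blk X Y i j) := by
      intro p hp
      induction hp using AddSubmonoid.closure_induction with
      | mem x hx =>
        obtain ⟨s, rfl⟩ := hx
        have := star_mul_mem_posCone (1 ⊗ₜ[ℂ] MulOpposite.op (star s) : Blk X Y i j)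
        rwa [TensorProduct.star_tmul, star_one, Algebra.TensorProduct.tmul_mul_tmul, one_mul,
          ← MulOpposite.op_star, star_star, ← MulOpposite.op_mul] at this
      | zero => rw [MulOpposite.op_zero, TensorProduct.tmul_zero]; exact zero_mem _
      | add x y _ _ hx hy =>
        rw [MulOpposite.op_add, TensorProduct.tmul_add]; exact add_mem hx hy
    rw [star_star] at this
    rw [TensorProduct.star_tmul, star_one, Algebra.TensorProduct.tmul_mul_tmul, one_mul,
      Algebra.TensorProduct.one_def, ← TensorProduct.tmul_smul, ← TensorProduct.tmul_sub,
      ← MulOpposite.op_star, ← MulOpposite.op_mul, ← MulOpposite.op_one, ← MulOpposite.op_smul,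
      ← MulOpposite.op_sub]
    exact key _ this
  have h3 := h1.mul (sq_nonneg _) h2
  rwa [Algebra.TensorProduct.tmul_mul_tmul, one_mul, mul_one] at h3

/-- The elementary tensor `a ⊗ b` in `ℓ^∞(X) ⊗̄ ℓ^∞(Y)^op`. -/
def Linf.tmul {X Y : QuantumSet} (a : X.Linf) (b : Y.Linf) : LinfTensor X Y :=
  ⟨fun p => a.1 p.1 ⊗ₜ MulOpposite.op (b.1 p.2), by
    obtain ⟨C, hC⟩ := a.2
    obtain ⟨D, hD⟩ := b.2
    refine ⟨C ^ 2 * D ^ 2 + 1, by positivity, fun p => ?_⟩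
    exact (starBdd_tmul (hC p.1) (hD p.2)).mono (by linarith)⟩

theorem WMor.sum_corner {X W : QuantumSet} (ψ : WMor X W) (a : X.Linf) (w : W.At) :
    ∑ i ∈ ψ.supp w, ψ.corner i w (a.1 i) = (ψ.toHom a).1 w := by
  rw [← mul_one ((ψ.toHom a).1 w), ← ψ.sum_corner_one w, Finset.mul_sum]
  refine Finset.sum_congr rfl fun i _ => ?_
  rw [← mul_one (a.1 i), ψ.corner_apply, ← Linf.mul_single, map_mul]
  rfl

/-- `ψ_ℓ ⊗̄ ψ_r` maps `a ⊗ b` to `ψ_ℓ(a) ⊗ ψ_r(b)`. -/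
theorem WMor.tensor_tmul {X Y Z W : QuantumSet} (ψl : WMor X W) (ψr : WMor Y Z) (a : X.Linf)
    (b : Y.Linf) :
    ψl.tensor ψr (Linf.tmul a b) = Linf.tmul (ψl.toHom a) (ψr.toHom b) := by
  refine Subtype.ext (funext fun q => ?_)
  change ∑ p ∈ ψl.supp q.1 ×ˢ ψr.supp q.2,
    ψl.corner p.1 q.1 (a.1 p.1) ⊗ₜ[ℂ] MulOpposite.op (ψr.corner p.2 q.2 (b.1 p.2)) =
      (ψl.toHom a).1 q.1 ⊗ₜ[ℂ] MulOpposite.op ((ψr.toHom b).1 q.2)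
  rw [sum_tmul_sum (ψl.supp q.1) (ψr.supp q.2) (fun i => ψl.corner i q.1 (a.1 i))
    (fun j => MulOpposite.op (ψr.corner j q.2 (b.1 j))), ψl.sum_corner, ← Finset.op_sum, ψr.sum_corner]

end Tmul

/-! ### The projection of a relation -/

section Proj

variable {X Y : QuantumSet} {i : X.At} {j : Y.At}

theorem blkAct_zero_left (n : Blk X Y i j) : blkAct (0 : Hom X Y i j) n = 0 := by
  induction n using TensorProduct.induction_on with
  | zero => simp
  | add x y hx hy => rw [map_add, hx, hy, add_zero]
  | tmul c d => simp

theorem blkAct_mul (x : Hom X Y i j) (m n : Blk X Y i j) :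
    blkAct x (m * n) = blkAct (blkAct x m) n := by
  have ha : ∀ (x y : Hom X Y i j) (n : Blk X Y i j),
      blkAct (x + y) n = blkAct x n + blkAct y n := by
    intro x y n
    induction n using TensorProduct.induction_on with
    | zero => simp
    | add s t hs ht => rw [map_add, map_add, map_add, hs, ht]; abel
    | tmul c d => simp
  induction m using TensorProduct.induction_on with
  | zero => rw [zero_mul, map_zero, blkAct_zero_left]
  | add s t hs ht => rw [add_mul, map_add, map_add, ha, hs, ht]
  | tmul a b =>
    induction n using TensorProduct.induction_on with
    | zero => simp
    | add s t hs ht => rw [mul_add, map_add, map_add, hs, ht]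
    | tmul c d =>
      rw [Algebra.TensorProduct.tmul_mul_tmul]
      ext v
      simp

/-- The rank-one operator `v ↦ ⟨f, v⟩ e`. -/
abbrev ketBra {E F : Type*} [NormedAddCommGroup E] [InnerProductSpace ℂ E] [NormedAddCommGroup F]
    [InnerProductSpace ℂ F] (e : E) (f : F) : F →L[ℂ] E := InnerProductSpace.rankOne ℂ e f

/-- The linear map `y ↦ ∑_{k,l} |e_k⟩⟨e_l| ⊗ |y e_l⟩⟨r e_k|` for an orthonormal basis `(e_k)` of
`X_i`. -/
def kern (r : Hom X Y i j) : Hom X Y i j →ₗ[ℂ] Blk X Y i j where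
  toFun y := ∑ k, ∑ l, ketBra (stdOrthonormalBasis ℂ (X.H i) k) (stdOrthonormalBasis ℂ (X.H i) l)
    ⊗ₜ MulOpposite.op (ketBra (y (stdOrthonormalBasis ℂ (X.H i) l))
      (r (stdOrthonormalBasis ℂ (X.H i) k)))
  map_add' y z := by
    simp only [← Finset.sum_add_distrib, ← TensorProduct.tmul_add, ← MulOpposite.op_add]
    refine Finset.sum_congr rfl fun k _ => Finset.sum_congr rfl fun l _ => ?_
    congr 2
    ext v
    simp
  map_smul' c y := by
    simp only [Finset.smul_sum, ← TensorProduct.tmul_smul, ← MulOpposite.op_smul, RingHom.id_apply]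
    refine Finset.sum_congr rfl fun k _ => Finset.sum_congr rfl fun l _ => ?_
    congr 2
    ext v
    simp [smul_comm c]

theorem kern_apply (r y : Hom X Y i j) : kern r y = ∑ k, ∑ l,
    ketBra (stdOrthonormalBasis ℂ (X.H i) k) (stdOrthonormalBasis ℂ (X.H i) l)
    ⊗ₜ MulOpposite.op (ketBra (y (stdOrthonormalBasis ℂ (X.H i) l))
      (r (stdOrthonormalBasis ℂ (X.H i) k))) := rfl

/-- The Hilbert-Schmidt inner product. -/
def hsInner (r x : Hom X Y i j) : ℂ :=
  ∑ k, inner ℂ (r (stdOrthonormalBasis ℂ (X.H i) k)) (x (stdOrthonormalBasis ℂ (X.H i) k))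

theorem star_kern (r : Hom X Y i j) : star (kern r r) = kern r r := by
  rw [kern_apply]
  simp only [star_sum, TensorProduct.star_tmul, ← MulOpposite.op_star]
  rw [Finset.sum_comm]
  refine Finset.sum_congr rfl fun k _ => Finset.sum_congr rfl fun l _ => ?_
  simp only [ContinuousLinearMap.star_eq_adjoint, InnerProductSpace.adjoint_rankOne]

theorem blkAct_kern (x r y : Hom X Y i j) : blkAct x (kern r y) = hsInner r x • y := by
  rw [kern_apply]
  simp only [map_sum, blkAct_tmul, MulOpposite.unop_op]
  rw [hsInner, Finset.sum_smul]
  refine Finset.sum_congr rfl fun k _ => ?_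
  ext v
  have hv := (stdOrthonormalBasis ℂ (X.H i)).sum_repr' v
  conv_rhs => rw [← hv]
  simp [smul_smul]

theorem kern_mul (r y : Hom X Y i j) (m : Blk X Y i j) :
    kern r y * m = kern r (blkAct y m) := by
  induction m using TensorProduct.induction_on with
  | zero => simp
  | add s t hs ht => rw [mul_add, map_add, map_add, hs, ht]
  | tmul a b =>
    rw [kern_apply, kern_apply, Finset.sum_mul]
    refine Finset.sum_congr rfl fun k _ => ?_
    set e := stdOrthonormalBasis ℂ (X.H i) with he
    have h1 : ∀ l, ketBra (e k) (e l) * a = ∑ n, inner ℂ (e l) (a (e n)) • ketBra (e k) (e n) := by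
      intro l
      ext v
      have hv := e.sum_repr' v
      conv_lhs => rw [← hv]
      simp [smul_smul, mul_comm]
    have h2 : ∀ n, ketBra (blkAct y (a ⊗ₜ b) (e n)) (r (e k)) =
        ∑ l, inner ℂ (e l) (a (e n)) • (b.unop * ketBra (y (e l)) (r (e k))) := by
      intro n
      have hv := e.sum_repr' (a (e n))
      ext v
      rw [blkAct_tmul]
      simp only [ContinuousLinearMap.comp_apply]
      conv_lhs => rw [← hv]
      simp [Finset.smul_sum, smul_smul, mul_comm]
    simp only [Finset.sum_mul, Algebra.TensorProduct.tmul_mul_tmul, h1, h2, Finset.op_sum,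
      TensorProduct.sum_tmul, TensorProduct.tmul_sum]
    rw [Finset.sum_comm]
    refine Finset.sum_congr rfl fun n _ => Finset.sum_congr rfl fun l _ => ?_
    rw [MulOpposite.op_smul, TensorProduct.smul_tmul, MulOpposite.op_mul, MulOpposite.op_unop]

theorem exists_blk_proj (R : Submodule ℂ (Hom X Y i j)) :
    ∃ P : Blk X Y i j, IsStarProjection P ∧ (∀ x ∈ R, blkAct x P = x) ∧
      ∀ m, (∀ x ∈ R, blkAct x m = 0) → P * m = 0 := by
  let e := stdOrthonormalBasis ℂ (X.H i)
  let Φ : Hom X Y i j →ₗ[ℂ] PiLp 2 (fun _ : Fin (Module.finrank ℂ (X.H i)) => Y.H j) :=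
    { toFun := fun x => WithLp.toLp 2 fun k => x (e k)
      map_add' := fun x y => by ext k; simp
      map_smul' := fun c x => by ext k; simp }
  have hΦ : ∀ x y : Hom X Y i j, inner ℂ (Φ x) (Φ y) = hsInner x y := by
    intro x y
    rw [PiLp.inner_apply]
    rfl
  have hinj : Function.Injective Φ := by
    intro x y h
    have hk : ∀ k, x (e k) = y (e k) := fun k => congrArg (fun t => t k) h
    ext v
    rw [← e.sum_repr' v]
    simp [hk]
  let b := stdOrthonormalBasis ℂ (R.map Φ)
  have hb : ∀ d, ∃ r ∈ R, Φ r = b d := fun d => (b d).2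
  choose r hrR hr using hb
  have hort : ∀ d d', hsInner (r d) (r d') = if d = d' then 1 else 0 := by
    intro d d'
    rw [← hΦ, hr, hr]
    exact orthonormal_iff_ite.1 b.orthonormal d d'
  have hexp : ∀ x ∈ R, ∑ d, hsInner (r d) x • r d = x := by
    intro x hx
    apply hinj
    rw [map_sum]
    have h := congrArg Subtype.val (b.sum_repr' ⟨Φ x, Submodule.mem_map_of_mem hx⟩)
    rw [AddSubmonoidClass.coe_finsetSum] at h
    refine Eq.trans ?_ h
    refine Finset.sum_congr rfl fun d _ => ?_
    rw [map_smul, ← hΦ, hr]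
    rfl
  refine ⟨∑ d, kern (r d) (r d), ⟨?_, ?_⟩, ?_, ?_⟩
  · change (∑ d, kern (r d) (r d)) * (∑ d, kern (r d) (r d)) = _
    rw [Finset.sum_mul_sum]
    refine Finset.sum_congr rfl fun d _ => ?_
    rw [Finset.sum_eq_single d]
    · rw [kern_mul, blkAct_kern, hort, if_pos rfl, one_smul]
    · intro d' _ h
      rw [kern_mul, blkAct_kern, hort, if_neg h, zero_smul, map_zero]
    · exact fun h => absurd (Finset.mem_univ d) h
  · change star _ = _
    rw [star_sum]
    exact Finset.sum_congr rfl fun d _ => star_kern _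
  · intro x hx
    rw [map_sum]
    simp only [blkAct_kern]
    exact hexp x hx
  · intro m hm
    rw [Finset.sum_mul]
    refine Finset.sum_eq_zero fun d _ => ?_
    rw [kern_mul, hm _ (hrR d), map_zero]

end Proj

/-- For every relation `R` there is a unique projection `P` of `ℓ^∞(X) ⊗̄ ℓ^∞(Y)^op` such that the
annihilator of `∏ R(X_i, Y_j)` is the right ideal generated by `1 - P`. -/
theorem Rel.existsUnique_proj {X Y : QuantumSet} (R : Rel X Y) :
    ∃! P : LinfTensor X Y, IsStarProjection P ∧ R.ann = {a | ∃ b, a = (1 - P) * b} := by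
  choose P hP hfix hann using fun p : X.At × Y.At => exists_blk_proj (R p.1 p.2)
  refine bddProd.existsUnique_proj _ P hP fun a => ?_
  constructor
  · intro ha p
    refine hann p _ fun x hx => ?_
    classical
    have h1 := ha (Function.update 0 p x) fun q => by
      rcases eq_or_ne q p with rfl | h
      · simpa using hx
      · simp [h]
    simpa using congrFun h1 p
  · intro ha x hx
    funext p
    change blkAct (x p) (a.1 p) = 0
    rw [← hfix p _ (hx p), ← blkAct_mul, ha p, map_zero]

/-- The projection `P_R` of `ℓ^∞(X) ⊗̄ ℓ^∞(Y)^op` of a relation `R` from `X` to `Y`: the projection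
with `Ann(R) = (1 - P_R) (ℓ^∞(X) ⊗̄ ℓ^∞(Y)^op)`. -/
def Rel.proj {X Y : QuantumSet} (R : Rel X Y) : LinfTensor X Y := R.existsUnique_proj.choose

theorem Rel.proj_spec {X Y : QuantumSet} (R : Rel X Y) :
    IsStarProjection R.proj ∧ R.ann = {a | ∃ b, a = (1 - R.proj) * b} :=
  R.existsUnique_proj.choose_spec.1

end QuantumSet

end

/-! Entrywise, `P_R` acts on `L(X_i, Y_j)` as a projection onto `R(X_i, Y_j)`, and this determines
it among the self-adjoint idempotents (`Rel.eq_proj`, `Rel.proj_act`). Since `ψl.tensor ψr` is a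
`*`-homomorphism, the image of `P_R` is again a projection. It remains to see that this image fixes
every element of `ψ̂_r† ∘ R ∘ ψ̂_ℓ` and maps everything into that relation.

Both facts rest on the description of `ψ̂(W_w, X_i)` as the maps `t` with `a t = t ψ_{iw}(a)`, where
`ψ_{iw} : L(X_i) → L(W_w)` is the corner of `ψ` (`WMor.mem_rel_iff`). For `t` in `ψ̂_ℓ` and `s` in
`ψ̂_r†`, the intertwining relations give `(s x t) · (ψ_ℓ ⊗̄ ψ_r)(m) = s (x · m_{ij}) t`
(`blkAct_tensorFun`). With `x` in `R` and `m = P_R` the right side is `s x t`, so the generators of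
the composite are fixed.

For the range, the unit of each corner has the form `∑ s s*` with every `s*` in `ψ̂`
(`WMor.exists_sum_corner_one`). Acting first by the unit of a corner therefore writes any `y` as a
sum of terms `r (r* y s) s*`. Acting then by the image of `P_R` replaces each middle factor by an
element of `R`, which lands in the composite (`blkAct_tensorCorner_mem`). -/

namespace QuantumSet

/-! ### The right action of a single block `L(X_i) ⊗ L(Y_j)^op` on `L(X_i, Y_j)`. -/

section Blk

variable {X Y : QuantumSet} {i : X.At} {j : Y.At}

theorem sum_ketBra_self {E : Type*} [NormedAddCommGroup E] [InnerProductSpace ℂ E]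
    [FiniteDimensional ℂ E] {ι : Type*} [Fintype ι] (e : OrthonormalBasis ι ℂ E) :
    ∑ k, ketBra (e k) (e k) = ContinuousLinearMap.id ℂ E := by
  ext v
  simpa using e.sum_repr' v

/-- Every linear functional on `L(X_i, Y_j)` is a Hilbert-Schmidt inner product. -/
theorem exists_hsInner_eq (φ : Hom X Y i j →ₗ[ℂ] ℂ) : ∃ r, ∀ x, hsInner r x = φ x := by
  let e := stdOrthonormalBasis ℂ (X.H i)
  -- Restrict `φ` to the operators supported on one basis vector `e k`. The Riesz vector of this
  -- functional on `Y_j` will be the value of `r` at `e k`.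
  let F : ∀ k, Y.H j →ₗ[ℂ] ℂ := fun k =>
    { toFun := fun y => φ (ketBra y (e k))
      map_add' := fun y z => by rw [← map_add]; congr 1; ext v; simp
      map_smul' := fun c y => by
        rw [RingHom.id_apply, ← map_smul]; congr 1; ext v; simp [smul_comm c] }
  let g : Fin (Module.finrank ℂ (X.H i)) → Y.H j := fun k =>
    (InnerProductSpace.toDual ℂ (Y.H j)).symm (LinearMap.toContinuousLinearMap (F k))
  have hg : ∀ k y, inner ℂ (g k) y = φ (ketBra y (e k)) := fun k y =>
    InnerProductSpace.toDual_symm_apply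
  have hr : ∀ k, (∑ l, ketBra (g l) (e l) : Hom X Y i j) (e k) = g k := by
    intro k
    simp [orthonormal_iff_ite.1 e.orthonormal]
  refine ⟨∑ l, ketBra (g l) (e l), fun x => ?_⟩
  have hx : ∑ k, ketBra (x (e k)) (e k) = x := by
    ext v
    conv_rhs => rw [← e.sum_repr' v]
    simp
  rw [hsInner]
  calc _ = ∑ k, φ (ketBra (x (e k)) (e k)) :=
        Finset.sum_congr rfl fun k _ => by rw [hr k, hg]
    _ = φ x := by rw [← map_sum, hx]

/-- The matrix units form a Hilbert-Schmidt orthonormal basis and `kern r r` acts as the rank-one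
projection onto `r`, so this is a resolution of the identity. A matrix unit built from `e_a` kills
the other basis vectors, so only `k = l = a` survives in its kernel, leaving `|e_a⟩⟨e_a| ⊗
|f_b⟩⟨f_b|`. -/
theorem sum_kern_self : ∑ a, ∑ b, kern
    (ketBra (stdOrthonormalBasis ℂ (Y.H j) b) (stdOrthonormalBasis ℂ (X.H i) a))
    (ketBra (stdOrthonormalBasis ℂ (Y.H j) b) (stdOrthonormalBasis ℂ (X.H i) a)) =
      (1 : Blk X Y i j) := by
  have h : ∀ a b, kern
      (ketBra (stdOrthonormalBasis ℂ (Y.H j) b) (stdOrthonormalBasis ℂ (X.H i) a))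
      (ketBra (stdOrthonormalBasis ℂ (Y.H j) b) (stdOrthonormalBasis ℂ (X.H i) a)) =
      ketBra (stdOrthonormalBasis ℂ (X.H i) a) (stdOrthonormalBasis ℂ (X.H i) a) ⊗ₜ[ℂ]
        MulOpposite.op (ketBra (stdOrthonormalBasis ℂ (Y.H j) b)
          (stdOrthonormalBasis ℂ (Y.H j) b)) := by
    intro a b
    rw [kern_apply, Finset.sum_eq_single a, Finset.sum_eq_single a]
    · simp
    · intro l _ hl
      have h0 : ketBra (0 : Y.H j) (stdOrthonormalBasis ℂ (Y.H j) b) = 0 := by ext v; simp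
      simp [orthonormal_iff_ite.1 (stdOrthonormalBasis ℂ (X.H i)).orthonormal, hl.symm, h0]
    · simp
    · intro k _ hk
      refine Finset.sum_eq_zero fun l _ => ?_
      simp [orthonormal_iff_ite.1 (stdOrthonormalBasis ℂ (X.H i)).orthonormal, hk.symm]
    · simp
  simp only [h, ← TensorProduct.tmul_sum, ← Finset.op_sum, ← TensorProduct.sum_tmul]
  rw [sum_ketBra_self, sum_ketBra_self]
  rfl

/-- The right action of `L(X_i) ⊗ L(Y_j)^op` on `L(X_i, Y_j)` is faithful. -/
theorem eq_zero_of_blkAct_eq_zero {n : Blk X Y i j} (h : ∀ x, blkAct x n = 0) : n = 0 := by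
  rw [← one_mul n, ← sum_kern_self, Finset.sum_mul]
  refine Finset.sum_eq_zero fun a _ => ?_
  rw [Finset.sum_mul]
  refine Finset.sum_eq_zero fun b _ => ?_
  rw [kern_mul, h, map_zero]

/-- If `x · P` were outside `R`, a functional `φ = hsInner r` would vanish on `R` but not at `x ·
P`. Then `kern r (x · P)` kills `R`, hence is killed by `P` on the left, although `x · P` acted on
by it is `φ(x · P)` times `x · P`, which is nonzero. -/
theorem blkAct_mem_of_forall_mul_eq_zero {R : Submodule ℂ (Hom X Y i j)} {P : Blk X Y i j}
    (hP : ∀ m, (∀ x ∈ R, blkAct x m = 0) → P * m = 0) (x : Hom X Y i j) : blkAct x P ∈ R := by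
  by_contra hx
  obtain ⟨φ, hφ, hR⟩ := Submodule.exists_le_ker_of_notMem hx
  obtain ⟨r, hr⟩ := exists_hsInner_eq φ
  have h := hP (kern r (blkAct x P)) fun y hy => by
    rw [blkAct_kern, hr, show φ y = 0 from hR hy, zero_smul]
  have h2 := blkAct_mul x P (kern r (blkAct x P))
  rw [h, map_zero, blkAct_kern, hr] at h2
  rcases smul_eq_zero.1 h2.symm with h3 | h3
  · exact hφ h3
  · exact hx (h3 ▸ zero_mem R)

end Blk

/-! ### The projection of a relation, characterised by its action. -/

section Proj

variable {X Y : QuantumSet}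

/-- `P_R` is the only projection that acts entrywise as a projection of `L(X_i, Y_j)` onto
`R(X_i, Y_j)`. -/
theorem Rel.eq_proj {R : Rel X Y} {Q : LinfTensor X Y} (hQ : IsStarProjection Q)
    (hfix : ∀ p : X.At × Y.At, ∀ x ∈ R p.1 p.2, blkAct x (Q.1 p) = x)
    (hmem : ∀ (p : X.At × Y.At) x, blkAct x (Q.1 p) ∈ R p.1 p.2) : Q = R.proj := by
  classical
  refine R.existsUnique_proj.unique ⟨hQ, ?_⟩ R.proj_spec
  -- The entries of `Q` have range `R`, so annihilating `R` means annihilating every `y · Q`. By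
  -- faithfulness of the action this is `Q * a = 0`.
  have hann : ∀ a, a ∈ R.ann ↔ Q * a = 0 := by
    intro a
    constructor
    · intro ha
      refine Subtype.ext (funext fun p => eq_zero_of_blkAct_eq_zero fun y => ?_)
      change blkAct y (Q.1 p * a.1 p) = 0
      rw [blkAct_mul]
      -- The annihilator tests whole families, so a single entry is probed by a family supported at
      -- `p`.
      have h1 := ha (Function.update 0 p (blkAct y (Q.1 p))) fun q => by
        rcases eq_or_ne q p with rfl | h
        · simpa using hmem q y
        · simp [h]
      simpa using congrFun h1 p
    · intro ha x hx
      funext p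
      change blkAct (x p) (a.1 p) = 0
      have h1 : Q.1 p * a.1 p = 0 := congrFun (congrArg Subtype.val ha) p
      rw [← hfix p _ (hx p), ← blkAct_mul, h1, map_zero]
  ext a
  rw [hann]
  constructor
  · intro h
    exact ⟨a, by rw [sub_mul, one_mul, h, sub_zero]⟩
  · rintro ⟨b, rfl⟩
    rw [← mul_assoc, mul_sub, mul_one, hQ.isIdempotentElem.eq, sub_self, zero_mul]

/-- `R.proj` is chosen through its annihilator alone, which does not show its entries. They are
recovered by assembling the blockwise projections of `exists_blk_proj` and applying uniqueness. -/
theorem Rel.proj_act (R : Rel X Y) :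
    (∀ p : X.At × Y.At, ∀ x ∈ R p.1 p.2, blkAct x (R.proj.1 p) = x) ∧
    ∀ (p : X.At × Y.At) x, blkAct x (R.proj.1 p) ∈ R p.1 p.2 := by
  choose P hP hfix hann using fun p : X.At × Y.At => exists_blk_proj (R p.1 p.2)
  let Q : LinfTensor X Y := ⟨P, 1, one_pos, fun p => starBdd_of_isStarProjection (hP p)⟩
  have hQ : IsStarProjection Q :=
    ⟨Subtype.ext (funext fun p => (hP p).isIdempotentElem),
      Subtype.ext (funext fun p => (hP p).isSelfAdjoint)⟩
  have hmem : ∀ (p : X.At × Y.At) x, blkAct x (P p) ∈ R p.1 p.2 := fun p =>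
    blkAct_mem_of_forall_mul_eq_zero (hann p)
  rw [← Rel.eq_proj hQ hfix hmem]
  exact ⟨hfix, hmem⟩

end Proj

/-! ### Corners of a `W*`-morphism and their intertwiners. -/

section Corner

variable {X W : QuantumSet} (ψ : WMor X W) {i : X.At} {w : W.At}

theorem Linf.single_mul (b : X.Linf) (i : X.At) (a : End X i) :
    Linf.single i a * b = Linf.single i (a * b.1 i) := by
  apply star_injective
  rw [star_mul, Linf.star_single, Linf.star_single, Linf.mul_single, star_mul]
  rfl

theorem WMor.corner_mul_apply (a : End X i) (b : X.Linf) :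
    ψ.corner i w a * (ψ.toHom b).1 w = ψ.corner i w (a * b.1 i) := by
  rw [ψ.corner_apply i w (a * b.1 i), ← Linf.single_mul, map_mul]
  rfl

/-- A corner need not be unital, so this has content: `t` vanishes off the range of the projection
`ψ.corner i w 1`. It is the intertwining relation at `a = 1`. -/
theorem WMor.comp_corner_one {t : Hom W X w i} (ht : ∀ a, a ∘L t = t ∘L ψ.corner i w a) :
    t ∘L ψ.corner i w 1 = t := by
  rw [← ht]
  rfl

theorem Linf.act_lp_single [DecidableEq W.At] (a : W.Linf) (v : W.H w) :
    Linf.act a (lp.single 2 w v) = lp.single 2 w (a.1 w v) := by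
  ext k
  rw [Linf.act_apply]
  rcases eq_or_ne k w with rfl | hk
  · simp
  · simp [hk]

/-- The relation of a `W*`-morphism consists of the intertwiners of its corners. -/
theorem WMor.mem_rel_iff {t : Hom W X w i} :
    t ∈ ψ.rel w i ↔ ∀ a, a ∘L t = t ∘L ψ.corner i w a := by
  classical
  constructor
  · rintro ⟨T, hT, rfl⟩ a
    ext v
    -- Test the intertwining relation of `T` on the element of `ℓ^∞(X)` supported at `i`, and on a
    -- vector supported at `w`.
    have h1 := congrArg (fun u : Hilb X => u i)
      (DFunLike.congr_fun (hT (Linf.single i a)) (lp.single 2 w v))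
    simp only [ContinuousLinearMap.comp_apply, Linf.act_apply, Linf.single_val,
      Pi.single_eq_same, Linf.act_lp_single, ← WMor.corner_apply] at h1
    convert h1 using 1 <;> simp [block] <;> congr!
  · intro ht
    -- The operator `T` is `t` extended by zero to all other blocks.
    refine ⟨lp.singleContinuousLinearMap ℂ X.H 2 i ∘L t ∘L lp.evalCLM ℂ W.H 2 w, fun b => ?_, ?_⟩
    · have hb : t ∘L (ψ.toHom b).1 w = b.1 i ∘L t := by
        have h := ψ.corner_mul_apply (w := w) (1 : End X i) b
        rw [one_mul] at h
        rw [ht, ← h, ContinuousLinearMap.mul_def, ← ContinuousLinearMap.comp_assoc,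
          ψ.comp_corner_one ht]
      ext1 v
      have h2 := DFunLike.congr_fun hb (v w)
      change Linf.act b (lp.single 2 i (t (v w))) = lp.single 2 i (t ((ψ.toHom b).1 w (v w)))
      rw [Linf.act_lp_single]
      exact congrArg _ h2.symm
    · ext v
      change (lp.single 2 i (t ((lp.single 2 w v : Hilb W) w)) : Hilb X) i = t v
      simp

/-- Taking adjoints reverses the intertwining relation and replaces `a` by `a*`, because corners
preserve the star. As `a` runs over all operators, so does `a*`. -/
theorem WMor.adjoint_mem_rel_iff {s : Hom X W i w} :
    ContinuousLinearMap.adjoint s ∈ ψ.rel w i ↔ ∀ a, ψ.corner i w a ∘L s = s ∘L a := by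
  have h : ∀ a : End X i, a ∘L ContinuousLinearMap.adjoint s =
      ContinuousLinearMap.adjoint s ∘L ψ.corner i w a ↔
      ψ.corner i w (star a) ∘L s = s ∘L star a := by
    intro a
    rw [← ContinuousLinearMap.adjoint.injective.eq_iff, ψ.corner_star]
    simp only [ContinuousLinearMap.adjoint_comp, ContinuousLinearMap.adjoint_adjoint,
      ContinuousLinearMap.star_eq_adjoint]
    exact eq_comm
  rw [ψ.mem_rel_iff]
  simp only [h]
  exact ⟨fun H a => by simpa using H (star a), fun H a => H _⟩

/-- The unit of a corner is a sum of products `s s*` with `s` intertwining the corner. -/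
theorem WMor.exists_sum_corner_one (i : X.At) (w : W.At) :
    ∃ (n : ℕ) (s : Fin n → Hom X W i w), (∀ k, ContinuousLinearMap.adjoint (s k) ∈ ψ.rel w i) ∧
      ∑ k, s k ∘L ContinuousLinearMap.adjoint (s k) = ψ.corner i w 1 := by
  -- The construction needs a unit vector `e₀` of `X_i`. If `X_i = 0`, the corner vanishes and the
  -- empty sum serves.
  rcases subsingleton_or_nontrivial (X.H i) with hX | hX
  · refine ⟨0, Fin.elim0, fun k => k.elim0, ?_⟩
    rw [Subsingleton.elim (1 : End X i) 0, map_zero]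
    simp
  let e := stdOrthonormalBasis ℂ (X.H i)
  let f := stdOrthonormalBasis ℂ (W.H w)
  let e₀ := e ⟨0, Module.finrank_pos⟩
  -- Set `s_k u = ψ_{iw}(|u⟩⟨e₀|) f_k`; it intertwines because `a |u⟩⟨e₀| = |a u⟩⟨e₀|`. Summing over
  -- the basis `(f_k)` of `W_w` gives `∑_k s_k s_k* = ∑_l ψ_{iw}(|e_l⟩⟨e₀|) ψ_{iw}(|e₀⟩⟨e_l|)`,
  -- which is `∑_l ψ_{iw}(|e_l⟩⟨e_l|) = ψ_{iw}(1)`.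
  let s : Fin (Module.finrank ℂ (W.H w)) → Hom X W i w := fun k => LinearMap.toContinuousLinearMap
    { toFun := fun u => ψ.corner i w (ketBra u e₀) (f k)
      map_add' := fun u v => by
        rw [← add_apply, ← map_add]; congr 2; ext x; simp
      map_smul' := fun c u => by
        rw [RingHom.id_apply, ← smul_apply, ← map_smul]
        congr 2; ext x; simp [smul_comm c] }
  have hs : ∀ k u, s k u = ψ.corner i w (ketBra u e₀) (f k) := fun _ _ => rfl
  refine ⟨_, s, fun k => ψ.adjoint_mem_rel_iff.2 fun a => ?_, ?_⟩
  · ext u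
    rw [ContinuousLinearMap.comp_apply, ContinuousLinearMap.comp_apply, hs, hs,
      ← mul_apply_eq_comp, ← ψ.corner_mul]
    congr 2
    ext x
    simp
  · ext v
    have hadj : ∀ k, ContinuousLinearMap.adjoint (s k) v =
        ∑ l, inner ℂ (f k) (ψ.corner i w (ketBra e₀ (e l)) v) • e l := by
      intro k
      rw [← e.sum_repr' (ContinuousLinearMap.adjoint (s k) v)]
      refine Finset.sum_congr rfl fun l _ => ?_
      rw [ContinuousLinearMap.adjoint_inner_right, hs,
        ← ContinuousLinearMap.adjoint_inner_right, ← ContinuousLinearMap.star_eq_adjoint,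
        ← ψ.corner_star, ContinuousLinearMap.star_eq_adjoint, InnerProductSpace.adjoint_rankOne]
    have hsum : ∀ l, ∑ k, inner ℂ (f k) (ψ.corner i w (ketBra e₀ (e l)) v) • s k (e l) =
        ψ.corner i w (ketBra (e l) (e l)) v := by
      intro l
      have hl : ketBra (e l) (e l) = ketBra (e l) e₀ * ketBra e₀ (e l) := by
        ext x
        simp [e₀]
      rw [hl, ψ.corner_mul, mul_apply_eq_comp]
      conv_rhs => rw [← f.sum_repr' (ψ.corner i w (ketBra e₀ (e l)) v), map_sum]
      simp only [hs, map_smul]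
    simp only [sum_apply, ContinuousLinearMap.comp_apply, hadj, map_sum,
      map_smul]
    rw [Finset.sum_comm]
    simp only [hsum]
    rw [← sum_apply, ← map_sum, sum_ketBra_self]
    rfl

end Corner

/-! ### The action of `ψ_ℓ ⊗̄ ψ_r` on composites with intertwiners. -/

section Tensor

variable {X Y Z W : QuantumSet} (ψl : WMor X W) (ψr : WMor Y Z)

theorem Rel.comp_mem_comp {S : Rel Y Z} {R : Rel X Y} {i : X.At} {j : Y.At} {k : Z.At}
    {s : Hom Y Z j k} (hs : s ∈ S j k) {r : Hom X Y i j} (hr : r ∈ R i j) :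
    s ∘L r ∈ S.comp R i k :=
  Submodule.subset_span ⟨j, s, hs, r, hr, rfl⟩

theorem Rel.adjoint_mem_dagger {R : Rel X Y} {i : X.At} {j : Y.At} {r : Hom X Y i j}
    (hr : r ∈ R i j) : ContinuousLinearMap.adjoint r ∈ R.dagger j i :=
  ⟨r, hr, rfl⟩

theorem blkAct_add_left {i : X.At} {j : Y.At} (x y : Hom X Y i j) (n : Blk X Y i j) :
    blkAct (x + y) n = blkAct x n + blkAct y n := by
  induction n using TensorProduct.induction_on with
  | zero => simp
  | add s t hs ht => rw [map_add, map_add, map_add, hs, ht]; abel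
  | tmul c d => simp

theorem blkAct_smul_left {i : X.At} {j : Y.At} (c : ℂ) (x : Hom X Y i j) (n : Blk X Y i j) :
    blkAct (c • x) n = c • blkAct x n := by
  induction n using TensorProduct.induction_on with
  | zero => simp
  | add s t hs ht => rw [map_add, map_add, smul_add, hs, ht]
  | tmul c d => simp

/-- The action of a fixed element of `L(X_i) ⊗ L(Y_j)^op`, as a linear map. -/
def blkActRight {i : X.At} {j : Y.At} (n : Blk X Y i j) : Hom X Y i j →ₗ[ℂ] Hom X Y i j where
  toFun x := blkAct x n
  map_add' x y := blkAct_add_left x y n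
  map_smul' c x := blkAct_smul_left c x n

/-- On an elementary tensor `a ⊗ b`, the intertwining relations move both corners inwards past `s`
and `t`: `ψ_r(b) s x t ψ_ℓ(a) = s b x a t`. -/
theorem blkAct_tensorCorner {i : X.At} {j : Y.At} {w : W.At} {z : Z.At} {t : Hom W X w i}
    (ht : t ∈ ψl.rel w i) {s : Hom Y Z j z} (hs : s ∈ ψr.rel.dagger j z) (x : Hom X Y i j)
    (n : Blk X Y i j) :
    blkAct (s ∘L x ∘L t) (ψl.tensorCorner ψr (i, j) (w, z) n) = s ∘L blkAct x n ∘L t := by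
  obtain ⟨r, hr, rfl⟩ := hs
  replace hr : ContinuousLinearMap.adjoint (ContinuousLinearMap.adjoint r) ∈ ψr.rel z j := by
    rwa [ContinuousLinearMap.adjoint_adjoint]
  rw [ψr.adjoint_mem_rel_iff] at hr
  rw [ψl.mem_rel_iff] at ht
  change blkAct (ContinuousLinearMap.adjoint r ∘L x ∘L t) _ =
    ContinuousLinearMap.adjoint r ∘L blkAct x n ∘L t
  generalize ContinuousLinearMap.adjoint r = s at hr
  induction n using TensorProduct.induction_on with
  | zero => simp
  | add m n hm hn =>
    simp only [map_add, hm, hn, ContinuousLinearMap.add_comp, ContinuousLinearMap.comp_add]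
  | tmul a b =>
    rw [ψl.tensorCorner_tmul ψr, blkAct_tmul, blkAct_tmul, MulOpposite.unop_op]
    calc (ψr.corner j z b.unop) ∘L (s ∘L x ∘L t) ∘L ψl.corner i w a
        = (ψr.corner j z b.unop ∘L s) ∘L x ∘L (t ∘L ψl.corner i w a) := rfl
      _ = _ := by rw [hr, ← ht]; rfl

/-- The action of `ψ_ℓ ⊗̄ ψ_r` on the product `s x t` of intertwiners `s`, `t` and `x`. -/
theorem blkAct_tensorFun {i : X.At} {j : Y.At} {w : W.At} {z : Z.At} {t : Hom W X w i}
    (ht : t ∈ ψl.rel w i) {s : Hom Y Z j z} (hs : s ∈ ψr.rel.dagger j z) (x : Hom X Y i j)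
    (m : ∀ p : X.At × Y.At, Blk X Y p.1 p.2) :
    blkAct (s ∘L x ∘L t) (ψl.tensorFun ψr (w, z) m) = s ∘L blkAct x (m (i, j)) ∘L t := by
  -- The map `s x t` is fixed by the unit of the `(i, j)` corner. Inserting this unit kills the
  -- other summands of `tensorFun`, since distinct corners are orthogonal.
  have h1 : blkAct (s ∘L x ∘L t) (ψl.tensorCorner ψr (i, j) (w, z) 1) = s ∘L x ∘L t := by
    rw [blkAct_tensorCorner ψl ψr ht hs]
    rfl
  rw [← blkAct_tensorCorner ψl ψr ht hs, ← h1, ← blkAct_mul, ← blkAct_mul,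
    ← ψl.tensorCorner_mul ψr, one_mul]
  congr 1
  rw [ψl.tensorFun_apply, Finset.mul_sum]
  by_cases hp : (i, j) ∈ ψl.supp w ×ˢ ψr.supp z
  · rw [Finset.sum_eq_single_of_mem _ hp fun p _ h => ψl.tensorCorner_mul_ne ψr h.symm _ _ _,
      ← ψl.tensorCorner_mul ψr, one_mul]
  -- The finite sum omits `(i, j)` only when its corner is zero, and then both sides vanish.
  · have h0 : ∀ n, ψl.tensorCorner ψr (i, j) (w, z) n = 0 := by
      intro n
      induction n using TensorProduct.induction_on with
      | zero => simp
      | add m n hm hn => rw [map_add, hm, hn, add_zero]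
      | tmul a b =>
        rw [ψl.tensorCorner_tmul ψr]
        rw [Finset.mem_product, not_and_or] at hp
        rcases hp with hp | hp
        · rw [ψl.corner_eq_zero hp, TensorProduct.zero_tmul]
        · rw [ψr.corner_eq_zero hp, MulOpposite.op_zero, TensorProduct.tmul_zero]
    rw [h0, h0]
    simp

/-- Acting by the unit of the corner turns `y` into `∑ r (r* y s) s*`, with `s*` in `ψ̂_ℓ` and `r`
in `ψ̂_r†`. The corner of `n` then acts on the middle factor `r* y s` alone and sends it into `R`.
-/
theorem blkAct_tensorCorner_mem (R : Rel X Y) (p : X.At × Y.At) (w : W.At) (z : Z.At)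
    (y : Hom W Z w z) {n : Blk X Y p.1 p.2} (hn : ∀ x, blkAct x n ∈ R p.1 p.2) :
    blkAct y (ψl.tensorCorner ψr p (w, z) n) ∈ (ψr.rel.dagger.comp R).comp ψl.rel w z := by
  obtain ⟨k, s, hs, hs1⟩ := ψl.exists_sum_corner_one p.1 w
  obtain ⟨l, r, hr, hr1⟩ := ψr.exists_sum_corner_one p.2 z
  have hr' : ∀ b, r b ∈ ψr.rel.dagger p.2 z := fun b => by
    have := Rel.adjoint_mem_dagger (hr b)
    rwa [ContinuousLinearMap.adjoint_adjoint] at this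
  have h1 : blkAct y (ψl.tensorCorner ψr p (w, z) 1) = ∑ a, ∑ b, r b ∘L
      (ContinuousLinearMap.adjoint (r b) ∘L y ∘L s a) ∘L ContinuousLinearMap.adjoint (s a) := by
    change (ψr.corner p.2 z 1) ∘L y ∘L ψl.corner p.1 w 1 = _
    rw [← hs1, ← hr1]
    ext v
    simp only [ContinuousLinearMap.comp_apply, sum_apply, map_sum]
  rw [← one_mul n, ψl.tensorCorner_mul ψr, blkAct_mul, h1]
  change blkActRight _ _ ∈ _
  rw [map_sum]
  refine sum_mem fun a _ => ?_
  rw [map_sum]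
  refine sum_mem fun b _ => ?_
  change blkAct _ _ ∈ _
  rw [blkAct_tensorCorner ψl ψr (hs a) (hr' b), ← ContinuousLinearMap.comp_assoc]
  exact Rel.comp_mem_comp (Rel.comp_mem_comp (hr' b) (hn _)) (hs a)

end Tensor

end QuantumSet

theorem mainTheorem5 {X Y Z W : QuantumSet} (R : QuantumSet.Rel X Y)
    (ψr : QuantumSet.WMor Y Z) (ψl : QuantumSet.WMor X W) :
    ψl.tensor ψr R.proj = ((ψr.rel.dagger.comp R).comp ψl.rel).proj := by
  obtain ⟨hfix, hmem⟩ := R.proj_act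
  refine QuantumSet.Rel.eq_proj ⟨?_, ?_⟩ ?_ ?_
  · exact R.proj_spec.1.isIdempotentElem.map (ψl.tensor ψr)
  · exact R.proj_spec.1.isSelfAdjoint.map (ψl.tensor ψr)
  · rintro ⟨w, z⟩ x hx
    rw [ψl.tensor_val ψr]
    -- The fixed points of the action form a subspace, so it suffices to check the generators of the
    -- composite.
    change x ∈ LinearMap.eqLocus
      (QuantumSet.blkActRight (ψl.tensorFun ψr (w, z) R.proj.1)) LinearMap.id
    refine Submodule.span_le.2 ?_ hx
    rintro _ ⟨i, y, hy, t, ht, rfl⟩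
    -- The composite is a span of products whose left factor `y` lies in another span. For fixed
    -- `t`, the `y` with `y t` fixed form a subspace too, which reduces to `y = s r`.
    suffices h : y ∈ (LinearMap.eqLocus
        (QuantumSet.blkActRight (ψl.tensorFun ψr (w, z) R.proj.1)) LinearMap.id).comap
        (ContinuousLinearMap.precomp _ t).toLinearMap from h
    refine Submodule.span_le.2 ?_ hy
    rintro _ ⟨j, s, hs, r, hr, rfl⟩
    change QuantumSet.blkAct ((s ∘L r) ∘L t) _ = (s ∘L r) ∘L t
    rw [ContinuousLinearMap.comp_assoc, QuantumSet.blkAct_tensorFun ψl ψr ht hs, hfix (i, j) r hr]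
  · rintro ⟨w, z⟩ y
    rw [ψl.tensor_val ψr, ψl.tensorFun_apply, map_sum]
    exact sum_mem fun p _ => QuantumSet.blkAct_tensorCorner_mem ψl ψr R p w z y (hmem p)
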